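/- Let $E,F$ be non-trivial finite groups, let $G,H$ be finitely generated groups, and let $M\lhd G$, $N\lhd H$ be normal subgroups such that $M$ is co-amenable in $G$, i.e. there is a finitely additive probability measure on the set of all subsets of $G/M$ which is invariant under left multiplication by $G$. Fix finite generating sets $S$ of $G$ and $T$ of $H$; equip $G,H$ with the Cayley graphs and word metrics of $S,T$, and $G/M,H/N$ with those of the images of $S,T$. A quasi-isometry $f\colon X\to Y$ between connected bounded degree graphs is called quasi-$k$-to-one ($k>0$) if there is $C>0$ with $$\bigl|\,k|A|-|f^{-1}(A)|\,\bigr|\le C\,|\partial_Y A|$$ for every finite set $A$ of vertices of $Y$, where $\partial_Y A$ is the set of vertices of $Y\setminus A$ adjacent to a vertex of $A$. A quasi-isometry $f\colon G\to H$ is a quasi-isometry of pairs $(G,M)\to(H,N)$ if there is $Q>0$ such that for every left coset $gM$ there is a left coset $hN$, and for every left coset $hN$ there is a left coset $gM$, with $d_{\mathrm{Haus}}(f(gM),hN)\le Q$. A map $\bar f\colon G/M\to H/N$ is induced by $f$ if the Hausdorff distance between $f(gM)$ and the coset $\bar f(gM)$ is bounded uniformly in $gM\in G/M$. Suppose that $|E|=n^r$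 and $|F|=n^s$ for some integers $n,r,s\ge 1$, and that there is a quasi-isometry of pairs $f\colon (G,M)\to(H,N)$ which is quasi-one-to-one and which induces a quasi-$\frac{s}{r}$-to-one quasi-isometry $\bar f\colon G/M\to H/N$. Then the permutational wreath products $$E\wr_{G/M}G=\Bigl(\bigoplus_{G/M}E\Bigr)\rtimes G\qquad\text{and}\qquad F\wr_{H/N}H=\Bigl(\bigoplus_{H/N}F\Bigr)\rtimes H$$ (where $G$, resp. $H$, permutes the coordinates through left multiplication on the cosets) are finitely generated and biLipschitz equivalent: for any finite generating sets of these two groups there are a bijection $\Phi\colon E\wr_{G/M}G\to F\wr_{H/N}H$ and a constant $C\ge 1$ with $\frac1C d(x,y)\le d(\Phi(x),\Phi(y))\le C\,d(x,y)$ for all $x,y\in E\wr_{G/M}G$, where $d$ denotes the word metrics. -/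

import Mathlib

/-! ## Large-scale geometry of graphs

The vertex set of a connected graph is a metric space for the graph distance `SimpleGraph.dist`.
All the graphs to which the notions below are applied are Cayley graphs with respect to finite
generating sets, so they are connected and of bounded degree. -/

/-- `f` is a `(C, K)`-quasi-isometry between the vertex sets of two connected graphs.
As the distance takes integer values, `d(y, f(X)) ≤ K` means that some `f x` is at distance
at most `K` from `y`. -/
structure IsQuasiIsometryWith {V W : Type*} (X : SimpleGraph V) (Y : SimpleGraph W)
    (C K : ℝ) (f : V → W) : Prop where
  one_le : 1 ≤ C
  nonneg : 0 ≤ K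
  upper : ∀ x y, (Y.dist (f x) (f y) : ℝ) ≤ C * X.dist x y + K
  lower : ∀ x y, 1 / C * X.dist x y - K ≤ (Y.dist (f x) (f y) : ℝ)
  dense : ∀ y, ∃ x, (Y.dist y (f x) : ℝ) ≤ K

/-- `f` is a quasi-isometry between the vertex sets of two connected graphs. -/
def IsQuasiIsometry {V W : Type*} (X : SimpleGraph V) (Y : SimpleGraph W) (f : V → W) : Prop :=
  ∃ C K : ℝ, IsQuasiIsometryWith X Y C K f

/-- The Hausdorff distance between the sets of vertices `A` and `B` is at most `Q`: each of the two
sets lies in the `Q`-neighborhood of the other (the infimum which defines the Hausdorff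
distance is attained, since the distance takes integer values). -/
def HausdorffDistLE {W : Type*} (Y : SimpleGraph W) (A B : Set W) (Q : ℝ) : Prop :=
  (∀ a ∈ A, ∃ b ∈ B, (Y.dist a b : ℝ) ≤ Q) ∧ (∀ b ∈ B, ∃ a ∈ A, (Y.dist b a : ℝ) ≤ Q)

/-- `f` is a quasi-isometry of pairs `(X, 𝒜) ⟶ (Y, ℬ)`, where `𝒜` and `ℬ` are collections of
subspaces of `X` and `Y`. -/
def IsQuasiIsometryOfPairs {V W : Type*} (X : SimpleGraph V) (𝒜 : Set (Set V))
    (Y : SimpleGraph W) (ℬ : Set (Set W)) (f : V → W) : Prop :=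
  IsQuasiIsometry X Y f ∧
    ∃ Q : ℝ, 0 < Q ∧
      (∀ A ∈ 𝒜, ∃ B ∈ ℬ, HausdorffDistLE Y (f '' A) B Q) ∧
      (∀ B ∈ ℬ, ∃ A ∈ 𝒜, HausdorffDistLE Y (f '' A) B Q)

/-- The boundary `∂A` of a set of vertices `A`: the vertices outside `A` with a neighbor in `A`. -/
def vertexBoundary {W : Type*} (Y : SimpleGraph W) (A : Set W) : Set W :=
  {y | y ∉ A ∧ ∃ x ∈ A, Y.Adj x y}

/-- `f` is a quasi-`k`-to-one quasi-isometry: `|k |A| - |f⁻¹(A)|| ≤ C |∂A|` for all finite sets `A`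
of vertices of `Y`. (For a quasi-isometry of connected bounded degree graphs the sets
`f⁻¹(A)` and `∂A` are finite.) -/
def IsQuasiToOne {V W : Type*} (X : SimpleGraph V) (Y : SimpleGraph W) (k : ℝ) (f : V → W) :
    Prop :=
  IsQuasiIsometry X Y f ∧
    ∃ C : ℝ, 0 < C ∧ ∀ A : Finset W,
      |k * (A.card : ℝ) - ((f ⁻¹' (A : Set W)).ncard : ℝ)| ≤
        C * ((vertexBoundary Y (A : Set W)).ncard : ℝ)

/-! ## Finitely generated groups -/

/-- `S` is a finite generating set of the group `G`. -/
def IsFiniteGeneratingSet {G : Type*} [Group G] (S : Set G) : Prop :=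
  S.Finite ∧ Subgroup.closure S = ⊤

/-- Two groups are biLipschitz equivalent: they are finitely generated and, for the word metrics
of any finite generating sets, there is a bijective `(C, 0)`-quasi-isometry between them. -/
def BiLipschitzEquivalentGroups (Γ Λ : Type*) [Group Γ] [Group Λ] : Prop :=
  Group.FG Γ ∧ Group.FG Λ ∧
    ∀ (U : Set Γ) (V : Set Λ), IsFiniteGeneratingSet U → IsFiniteGeneratingSet V →
      ∃ (Φ : Γ ≃ Λ) (C : ℝ),
        IsQuasiIsometryWith (SimpleGraph.mulCayley U) (SimpleGraph.mulCayley V) C 0 Φ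

/-- The left coset of `M` which is the point `a` of `G ⧸ M`, as a subset of `G`. -/
def cosetSet {G : Type*} [Group G] (M : Subgroup G) (a : G ⧸ M) : Set G :=
  {g | (QuotientGroup.mk g : G ⧸ M) = a}

/-- The collection of the left cosets of `M` in `G`. -/
def leftCosets {G : Type*} [Group G] (M : Subgroup G) : Set (Set G) :=
  Set.range (cosetSet M)

/-- The image in `G ⧸ M` of a subset of `G`. -/
def quotientSet {G : Type*} [Group G] (M : Subgroup G) (S : Set G) : Set (G ⧸ M) :=
  (fun g : G => (QuotientGroup.mk g : G ⧸ M)) '' S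

/-- `fbar` is a map induced by `f` on the quotients: for some `Q`, the image under `f` of any left
coset `a` of `M` is at Hausdorff distance at most `Q` from the left coset `fbar a` of `N`. Here
`H` has the metric of the graph `Y`. -/
def IsInducedMap {G H : Type*} [Group G] [Group H] (M : Subgroup G) (N : Subgroup H)
    (Y : SimpleGraph H) (f : G → H) (fbar : G ⧸ M → H ⧸ N) : Prop :=
  ∃ Q : ℝ, ∀ a : G ⧸ M, HausdorffDistLE Y (f '' cosetSet M a) (cosetSet N (fbar a)) Q

/-- The action of `G` on `X` is amenable: there is an invariant finitely additive probability
measure defined on all the subsets of `X`. -/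
def IsAmenableAction (G X : Type*) [Group G] [MulAction G X] : Prop :=
  ∃ μ : Set X → ℝ, (∀ A, 0 ≤ μ A) ∧ μ Set.univ = 1 ∧
    (∀ A B, Disjoint A B → μ (A ∪ B) = μ A + μ B) ∧
    ∀ (g : G) (A : Set X), μ ((fun x => g • x) '' A) = μ A

/-- `M` is co-amenable in `G`: the action of `G` on `G ⧸ M` by left multiplication is amenable. -/
def IsCoAmenable {G : Type*} [Group G] (M : Subgroup G) : Prop :=
  IsAmenableAction G (G ⧸ M)

/-! ## Permutational wreath products -/

/-- The direct sum `⨁_X E` of copies of the (possibly non-abelian) group `E`: the functions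
`X → E` with finite support, with the pointwise product. -/
def groupDirectSum (X E : Type*) [Group E] : Subgroup (X → E) where
  carrier := {c | (Function.mulSupport c).Finite}
  one_mem' := by simp
  mul_mem' {a b} ha hb := (Set.Finite.union ha hb).subset (Function.mulSupport_mul a b)
  inv_mem' {a} ha := by simpa using ha

theorem mem_groupDirectSum {X E : Type*} [Group E] (c : X → E) :
    c ∈ groupDirectSum X E ↔ (Function.mulSupport c).Finite := Iff.rfl

theorem shift_mem_groupDirectSum {X E G : Type*} [Group E] [Group G] [MulAction G X] (g : G)
    {c : X → E} (hc : c ∈ groupDirectSum X E) :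
    (fun x => c (g • x)) ∈ groupDirectSum X E := by
  rw [mem_groupDirectSum] at hc ⊢
  exact hc.preimage (MulAction.injective g).injOn

/-- The action of `G` on `⨁_X E` which permutes the coordinates: `(g • c) x = c (g⁻¹ • x)`. -/
def permAction (E X G : Type*) [Group E] [Group G] [MulAction G X] :
    G →* MulAut (groupDirectSum X E) where
  toFun g :=
    { toFun := fun c => ⟨fun x => c.1 (g⁻¹ • x), shift_mem_groupDirectSum g⁻¹ c.2⟩
      invFun := fun c => ⟨fun x => c.1 (g • x), shift_mem_groupDirectSum g c.2⟩
      left_inv := fun c => by ext x; simp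
      right_inv := fun c => by ext x; simp
      map_mul' := fun c d => rfl }
  map_one' := by ext c x; simp
  map_mul' g h := by ext c x; simp [mul_smul]

/-- The permutational wreath product `E ≀_X G = (⨁_X E) ⋊ G`. -/
abbrev PermWreath (E X G : Type*) [Group E] [Group G] [MulAction G X] : Type _ :=
  SemidirectProduct (groupDirectSum X E) G (permAction E X G)

/-! Choose an alphabet `A` of `n` letters and write elements of `E` and `F` as words of length `r`
and `s`, both identities being the same constant letter. A lamp configuration on `G ⧸ M` then
assigns a letter to each point of `G ⧸ M × Fin r`, and one on `H ⧸ N` to each point of `H ⧸ N × Fin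
s`.

A quasi-`s/r`-to-one map is at bounded distance from a bijection between `r` copies of its domain
and `s` copies of its range (`exists_equiv_prod_fin_dist_le`). This comes from Hall's theorem in
both directions and Schröder–Bernstein. Applied to `fbar` it gives `φ`, which transports letters;
applied to `f` with `r = s = 1` it gives a bijection `ψ : G ≃ H`, which moves the cursor.

The bijection `(c, g) ↦ (recode c, ψ g)` is biLipschitz (`hasFiniteIncrements_wreathEquiv`). Moving
the cursor does not affect the recoded lamps. Changing the lamp at `gM` changes only lamps near
`fbar (gM)`, which is near `ψ(g)N` because `fbar` is induced by `f` and `ψ` is close to `f`. Seen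
from the new cursor these lamps lie in a fixed finite set, so only finitely many increments occur.
The inverse has the same form. -/

open scoped Pointwise

/-! ## Graphs and Cayley graphs -/

theorem SimpleGraph.Connected.dist_map_le {V W : Type*} {X : SimpleGraph V} {Y : SimpleGraph W}
    (hX : X.Connected) (hY : Y.Connected) {φ : V → W} {D : ℕ}
    (h : ∀ x y, X.Adj x y → Y.dist (φ x) (φ y) ≤ D) (x y : V) :
    Y.dist (φ x) (φ y) ≤ D * X.dist x y := by
  obtain ⟨p, hp⟩ := hX.exists_walk_length_eq_dist x y
  rw [← hp]
  clear hp
  induction p with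
  | nil => simp
  | cons hadj p ih =>
    rw [SimpleGraph.Walk.length_cons, mul_add, mul_one, add_comm]
    exact hY.dist_triangle.trans (add_le_add (h _ _ hadj) ih)

section Cayley

variable {G : Type*} [Group G] {S : Set G}

theorem mulCayley_connected (hS : Subgroup.closure S = ⊤) :
    (SimpleGraph.mulCayley S).Connected := by
  have key : ∀ g a : G, (SimpleGraph.mulCayley S).Reachable a (a * g) := by
    intro g
    have hg : g ∈ Subgroup.closure S := hS ▸ Subgroup.mem_top g
    induction hg using Subgroup.closure_induction with
    | mem g hg =>
      intro a
      by_cases h : a = a * g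
      · rw [← h]
      · refine SimpleGraph.Adj.reachable ?_
        rw [SimpleGraph.mulCayley_adj]
        exact ⟨h, Or.inl (by simpa using hg)⟩
    | one => intro a; simp
    | mul x y _ _ hx hy => intro a; rw [← mul_assoc]; exact (hx a).trans (hy (a * x))
    | inv x _ hx => intro a; simpa using (hx (a * x⁻¹)).symm
  have : Nonempty G := ⟨1⟩
  exact ⟨fun a b => by simpa using key (a⁻¹ * b) a⟩

theorem mulCayley_dist_mul_left (hS : Subgroup.closure S = ⊤) (g a b : G) :
    (SimpleGraph.mulCayley S).dist (g * a) (g * b) = (SimpleGraph.mulCayley S).dist a b := by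
  have hc := mulCayley_connected hS
  have key : ∀ g a b : G,
      (SimpleGraph.mulCayley S).dist (g * a) (g * b) ≤ (SimpleGraph.mulCayley S).dist a b := by
    intro g a b
    simpa using hc.dist_map_le hc (φ := fun x => g * x) (D := 1) (fun x y hxy =>
      (SimpleGraph.dist_eq_one_iff_adj.mpr (SimpleGraph.mulCayley_adj_mul_iff_right.mpr hxy)).le)
      a b
  refine le_antisymm (key g a b) ?_
  simpa using key g⁻¹ (g * a) (g * b)

theorem mulCayley_dist_one (hS : Subgroup.closure S = ⊤) (a b : G) :
    (SimpleGraph.mulCayley S).dist 1 (a⁻¹ * b) = (SimpleGraph.mulCayley S).dist a b := by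
  simpa using (mulCayley_dist_mul_left hS a 1 (a⁻¹ * b)).symm

theorem mulCayley_walk_mem_pow {a b : G} (p : (SimpleGraph.mulCayley S).Walk a b) :
    a⁻¹ * b ∈ (S ∪ S⁻¹) ^ p.length := by
  induction p with
  | nil => simp
  | @cons u v w h p ih =>
    rw [SimpleGraph.Walk.length_cons, pow_succ']
    rw [SimpleGraph.mulCayley_adj] at h
    refine ⟨u⁻¹ * v, ?_, v⁻¹ * w, ih, by simp [mul_assoc]⟩
    rcases h.2 with h | h
    · exact Or.inl h
    · exact Or.inr (by simpa using h)

theorem mulCayley_ball_finite (hS : IsFiniteGeneratingSet S) (n : ℕ) :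
    {g | (SimpleGraph.mulCayley S).dist 1 g ≤ n}.Finite := by
  have hfin : (S ∪ S⁻¹).Finite := hS.1.union hS.1.inv
  have hpow : ∀ k : ℕ, ((S ∪ S⁻¹) ^ k).Finite := by
    intro k
    induction k with
    | zero => simp
    | succ k ih => rw [pow_succ]; exact ih.mul hfin
  refine ((Set.finite_Iic n).biUnion fun k _ => hpow k).subset ?_
  intro g hg
  obtain ⟨p, hp⟩ := (mulCayley_connected hS.2).exists_walk_length_eq_dist 1 g
  refine Set.mem_biUnion (x := p.length) (by rw [Set.mem_Iic, hp]; exact hg) ?_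
  simpa using mulCayley_walk_mem_pow p

theorem mulCayley_ball_eq_smul (hS : Subgroup.closure S = ⊤) (a : G) (n : ℕ) :
    {g | (SimpleGraph.mulCayley S).dist a g ≤ n} =
      (fun g => a * g) '' {g | (SimpleGraph.mulCayley S).dist 1 g ≤ n} := by
  ext g
  simp only [Set.mem_ofPred_eq, Set.mem_image]
  refine ⟨fun h => ⟨a⁻¹ * g, by rwa [mulCayley_dist_one hS], by simp⟩, ?_⟩
  rintro ⟨x, hx, rfl⟩
  simpa using (mulCayley_dist_mul_left hS a 1 x).le.trans hx

theorem mulCayley_ball_finite' (hS : IsFiniteGeneratingSet S) (a : G) (n : ℕ) :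
    {g | (SimpleGraph.mulCayley S).dist a g ≤ n}.Finite := by
  rw [mulCayley_ball_eq_smul hS.2]
  exact (mulCayley_ball_finite hS n).image _

theorem mulCayley_ball_ncard (hS : Subgroup.closure S = ⊤) (a : G) (n : ℕ) :
    {g | (SimpleGraph.mulCayley S).dist a g ≤ n}.ncard =
      {g | (SimpleGraph.mulCayley S).dist 1 g ≤ n}.ncard := by
  rw [mulCayley_ball_eq_smul hS]
  exact Set.ncard_image_of_injective _ (mul_right_injective a)

end Cayley

/-! ## Lipschitz maps between finitely generated groups -/

/-- For all `u`, the elements `(Φ γ)⁻¹ * Φ (γ * u)` take finitely many values: for finitely generated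
groups, this means that `Φ` is Lipschitz for the word metrics. -/
def HasFiniteIncrements {Γ Λ : Type*} [Group Γ] [Group Λ] (Φ : Γ → Λ) : Prop :=
  ∀ u : Γ, (Set.range fun γ => (Φ γ)⁻¹ * Φ (γ * u)).Finite

section Increments

variable {Γ Λ : Type*} [Group Γ] [Group Λ]

/-- Increments satisfy a cocycle rule: those along `x * y` are products of increments along `x` and
along `y`, and those along `x⁻¹` are inverses of increments along `x`. -/
theorem HasFiniteIncrements.of_closure {P : Set Γ} (hP : Subgroup.closure P = ⊤) {Φ : Γ → Λ}
    (h : ∀ u ∈ P, (Set.range fun γ => (Φ γ)⁻¹ * Φ (γ * u)).Finite) : HasFiniteIncrements Φ := by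
  intro u
  have hu : u ∈ Subgroup.closure P := hP ▸ Subgroup.mem_top u
  induction hu using Subgroup.closure_induction with
  | mem u hu => exact h u hu
  | one => exact (Set.finite_singleton (1 : Λ)).subset (by rintro _ ⟨γ, rfl⟩; simp)
  | mul x y _ _ hx hy =>
    refine (hx.mul hy).subset ?_
    rintro _ ⟨γ, rfl⟩
    exact ⟨_, ⟨γ, rfl⟩, _, ⟨γ * x, rfl⟩, by simp [mul_assoc]⟩
  | inv x _ hx =>
    refine hx.inv.subset ?_
    rintro _ ⟨γ, rfl⟩
    exact Set.mem_inv.mpr ⟨γ * x⁻¹, by simp⟩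

theorem HasFiniteIncrements.exists_dist_le {Φ : Γ → Λ} (h : HasFiniteIncrements Φ)
    {U : Set Γ} {V : Set Λ} (hU : IsFiniteGeneratingSet U) (hV : Subgroup.closure V = ⊤) :
    ∃ D : ℕ, ∀ x y, (SimpleGraph.mulCayley V).dist (Φ x) (Φ y) ≤
      D * (SimpleGraph.mulCayley U).dist x y := by
  have hfin : (⋃ u ∈ U, Set.range fun γ => (Φ γ)⁻¹ * Φ (γ * u)).Finite :=
    hU.1.biUnion fun u _ => h u
  obtain ⟨D, hD⟩ := (hfin.image fun z => (SimpleGraph.mulCayley V).dist 1 z).bddAbove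
  have hstep : ∀ x y, x⁻¹ * y ∈ U → (SimpleGraph.mulCayley V).dist (Φ x) (Φ y) ≤ D := by
    intro x y hxy
    refine hD ⟨(Φ x)⁻¹ * Φ y, Set.mem_biUnion hxy ⟨x, by simp⟩, ?_⟩
    exact mulCayley_dist_one hV _ _
  refine ⟨D, (mulCayley_connected hU.2).dist_map_le (mulCayley_connected hV) ?_⟩
  intro x y hxy
  rcases ((SimpleGraph.mulCayley_adj _ _ _).mp hxy).2 with h | h
  · exact hstep x y h
  · rw [SimpleGraph.dist_comm]; exact hstep y x h

theorem hasFiniteIncrements_of_dist_le {U : Set Γ} {V : Set Λ} (hV : IsFiniteGeneratingSet V)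
    (hU : Subgroup.closure U = ⊤) {Φ : Γ → Λ} (D : ℕ → ℕ)
    (h : ∀ x y, (SimpleGraph.mulCayley V).dist (Φ x) (Φ y) ≤
      D ((SimpleGraph.mulCayley U).dist x y)) : HasFiniteIncrements Φ := by
  intro u
  refine (mulCayley_ball_finite hV (D ((SimpleGraph.mulCayley U).dist 1 u))).subset ?_
  rintro _ ⟨γ, rfl⟩
  have := h γ (γ * u)
  rwa [← mulCayley_dist_one hV.2, ← mulCayley_dist_one hU γ, inv_mul_cancel_left] at this

theorem BiLipschitzEquivalentGroups.of_hasFiniteIncrements (hΓ : Group.FG Γ) (hΛ : Group.FG Λ)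
    (Φ : Γ ≃ Λ) (h : HasFiniteIncrements Φ) (h' : HasFiniteIncrements Φ.symm) :
    BiLipschitzEquivalentGroups Γ Λ := by
  refine ⟨hΓ, hΛ, fun U V hU hV => ⟨Φ, ?_⟩⟩
  obtain ⟨D, hD⟩ := h.exists_dist_le hU hV.2
  obtain ⟨D', hD'⟩ := h'.exists_dist_le hV hU.2
  have hC : (0 : ℝ) < D + D' + 1 := by positivity
  refine ⟨D + D' + 1, by linarith [(D.cast_nonneg : (0 : ℝ) ≤ D), (D'.cast_nonneg : (0 : ℝ) ≤ D')],
    le_rfl, fun x y => ?_, fun x y => ?_, fun y => ⟨Φ.symm y, by simp⟩⟩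
  · have : ((SimpleGraph.mulCayley V).dist (Φ x) (Φ y) : ℝ) ≤
        D * (SimpleGraph.mulCayley U).dist x y := by exact_mod_cast hD x y
    nlinarith [((SimpleGraph.mulCayley U).dist x y).cast_nonneg (α := ℝ),
      (D'.cast_nonneg : (0 : ℝ) ≤ D')]
  · have : ((SimpleGraph.mulCayley U).dist x y : ℝ) ≤
        D' * (SimpleGraph.mulCayley V).dist (Φ x) (Φ y) := by
      exact_mod_cast (by simpa using hD' (Φ x) (Φ y))
    rw [sub_zero, one_div, inv_mul_le_iff₀ hC]
    nlinarith [((SimpleGraph.mulCayley V).dist (Φ x) (Φ y)).cast_nonneg (α := ℝ),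
      (D.cast_nonneg : (0 : ℝ) ≤ D)]

end Increments

/-! ## From quasi-`k`-to-one maps to bijections at bounded distance -/

/-- Among `J` consecutive increments of a monotone sequence, one is at most the average. -/
theorem exists_mul_increment_le {J : ℕ} (hJ : 0 < J) (b : ℕ → ℝ) :
    ∃ j < J, J * (b (j + 1) - b j) ≤ b J - b 0 := by
  by_contra! h
  have hsum := Finset.sum_lt_sum_of_nonempty (Finset.nonempty_range_iff.mpr hJ.ne')
    fun j hj => h j (Finset.mem_range.mp hj)
  rw [← Finset.mul_sum, Finset.sum_range_sub, Finset.sum_const, Finset.card_range,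
    nsmul_eq_mul] at hsum
  exact lt_irrefl _ hsum

/-- The set of vertices at distance at most `n` from `A`. -/
def graphThickening {W : Type*} (Y : SimpleGraph W) (A : Set W) (n : ℕ) : Set W :=
  {w | ∃ a ∈ A, Y.dist a w ≤ n}

/-! ### Growth of neighborhoods. -/

section Thickening

variable {W : Type*} {Y : SimpleGraph W} {A : Set W}

theorem graphThickening_mono {m n : ℕ} (h : m ≤ n) :
    graphThickening Y A m ⊆ graphThickening Y A n :=
  fun _ ⟨a, ha, hw⟩ => ⟨a, ha, hw.trans h⟩

theorem subset_graphThickening (n : ℕ) : A ⊆ graphThickening Y A n :=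
  fun a ha => ⟨a, ha, by simp⟩

theorem finite_graphThickening (hball : ∀ y n, {w | Y.dist y w ≤ n}.Finite) (hA : A.Finite)
    (n : ℕ) : (graphThickening Y A n).Finite :=
  (hA.biUnion fun a _ => hball a n).subset fun _ ⟨_, ha, hw⟩ => Set.mem_biUnion ha hw

theorem mem_graphThickening_add (hY : Y.Connected) {m n : ℕ} {x y : W}
    (hx : x ∈ graphThickening Y A m) (hxy : Y.dist x y ≤ n) : y ∈ graphThickening Y A (m + n) := by
  obtain ⟨a, ha, hax⟩ := hx
  exact ⟨a, ha, hY.dist_triangle.trans (add_le_add hax hxy)⟩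

theorem vertexBoundary_graphThickening_subset (hY : Y.Connected) (n : ℕ) :
    vertexBoundary Y (graphThickening Y A n) ⊆
      graphThickening Y A (n + 1) \ graphThickening Y A n := by
  rintro y ⟨hy, x, hx, hxy⟩
  exact ⟨mem_graphThickening_add hY hx (SimpleGraph.dist_eq_one_iff_adj.mpr hxy).le, hy⟩

theorem ncard_vertexBoundary_graphThickening_le (hY : Y.Connected)
    (hball : ∀ y n, {w | Y.dist y w ≤ n}.Finite) (hA : A.Finite) (n : ℕ) :
    ((vertexBoundary Y (graphThickening Y A n)).ncard : ℝ) ≤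
      (graphThickening Y A (n + 1)).ncard - (graphThickening Y A n).ncard := by
  have hfin := finite_graphThickening hball hA
  have h1 := Set.ncard_le_ncard (vertexBoundary_graphThickening_subset (A := A) hY n)
    ((hfin (n + 1)).subset Set.sdiff_subset)
  have h2 := Set.ncard_sdiff_add_ncard_of_subset
    (graphThickening_mono (Y := Y) (A := A) (Nat.le_add_right n 1)) (hfin (n + 1))
  rw [le_sub_iff_add_le]
  exact_mod_cast (by omega : _ + _ ≤ _)

/-- If `f` is coarsely onto, then the preimage of `Q` is not much smaller than a set whose
`K`-neighborhood lies in `Q`. -/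
theorem ncard_le_mul_ncard_preimage {V : Type*} {f : V → W} {K β : ℕ}
    (hβ : ∀ y, {w | Y.dist y w ≤ K}.ncard ≤ β) (hball : ∀ y n, {w | Y.dist y w ≤ n}.Finite)
    (hf : ∀ y, ∃ x, Y.dist y (f x) ≤ K) (hfib : ∀ Q : Set W, Q.Finite → (f ⁻¹' Q).Finite)
    {P Q : Set W} (hQ : Q.Finite) (hPQ : ∀ y ∈ P, ∀ z, Y.dist y z ≤ K → z ∈ Q) :
    P.ncard ≤ β * (f ⁻¹' Q).ncard := by
  classical
  choose g hg using hf
  have hP : P.Finite := hQ.subset fun y hy => hPQ y hy y (by simp)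
  rw [Set.ncard_eq_toFinset_card P hP, Set.ncard_eq_toFinset_card _ (hfib Q hQ)]
  refine Finset.card_le_mul_card_image_of_maps_to (f := g) ?_ β ?_
  · intro y hy
    rw [Set.Finite.mem_toFinset] at hy ⊢
    exact hPQ y hy _ (hg y)
  · intro x _
    refine le_trans ?_ (hβ (f x))
    rw [← Set.ncard_coe_finset]
    refine Set.ncard_le_ncard ?_ (hball _ _)
    intro y hy
    simp only [Finset.coe_filter, Set.mem_ofPred_eq] at hy ⊢
    rw [SimpleGraph.dist_comm, ← hy.2]
    exact hg y

end Thickening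

/-! ### Hall's condition and the matching. -/

section Matching

theorem card_le_mul_card_image_fst {Z : Type*} [DecidableEq Z] {k : ℕ} (B : Finset (Z × Fin k)) :
    B.card ≤ k * (B.image Prod.fst).card := by
  refine (Finset.card_le_card (Finset.subset_product (s := B))).trans ?_
  rw [Finset.card_product, mul_comm]
  exact Nat.mul_le_mul_right _ ((Finset.card_le_univ _).trans (by simp))

variable {V W : Type*} {Y : SimpleGraph W} {f : V → W} {K β r s : ℕ} {C : ℝ}

theorem ncard_preimage_sdiff (hfib : ∀ Q : Set W, Q.Finite → (f ⁻¹' Q).Finite) {P Q : Set W}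
    (hPQ : P ⊆ Q) (hQ : Q.Finite) :
    ((f ⁻¹' Q).ncard : ℝ) = (f ⁻¹' (Q \ P)).ncard + (f ⁻¹' P).ncard := by
  rw [Set.preimage_sdiff]
  exact_mod_cast (Set.ncard_sdiff_add_ncard_of_subset (Set.preimage_mono hPQ) (hfib Q hQ)).symm

/-- Hall's condition from domain to range, with no case distinction on amenability. The estimate is
applied to a neighborhood `B` of `A` chosen where growth is slow. Its boundary error is then
absorbed by the points beyond `B` in the larger neighborhood and by the fibers over `B \ A`. -/
theorem exists_mul_ncard_preimage_le (hY : Y.Connected)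
    (hball : ∀ y n, {w | Y.dist y w ≤ n}.Finite)
    (hβ : ∀ y, {w | Y.dist y w ≤ K}.ncard ≤ β) (hβ0 : 0 < β)
    (hf : ∀ y, ∃ x, Y.dist y (f x) ≤ K) (hfib : ∀ Q : Set W, Q.Finite → (f ⁻¹' Q).Finite)
    (hr : 1 ≤ r) (hs : 1 ≤ s) (hC : 0 < C)
    (hk : ∀ A : Set W, A.Finite →
      |(s * A.ncard : ℝ) - r * (f ⁻¹' A).ncard| ≤ C * (vertexBoundary Y A).ncard) :
    ∃ R : ℕ, ∀ A : Set W, A.Finite →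
      r * (f ⁻¹' A).ncard ≤ s * (graphThickening Y A R).ncard := by
  obtain ⟨J, hJ⟩ := exists_nat_ge (C * β + 1)
  have hβ' : (0 : ℝ) < β := by exact_mod_cast hβ0
  have hJ0 : 0 < J := by
    have : (0 : ℝ) < J := lt_of_lt_of_le (by positivity) hJ
    exact_mod_cast this
  -- There are `J` windows of width `K + 1`: room for a `K`-ball plus one boundary layer. They start
  -- at radius `K` so that `K`-balls around points beyond it miss `A`.
  refine ⟨K + (K + 1) * J, fun A hA => ?_⟩
  have hfin := finite_graphThickening hball hA
  obtain ⟨b, hb⟩ : ∃ b : ℕ → ℝ, ∀ n, b n = ((graphThickening Y A n).ncard : ℝ) := ⟨_, fun _ => rfl⟩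
  have hbmono : ∀ m n, m ≤ n → b m ≤ b n := fun m n h => by
    rw [hb, hb]; exact_mod_cast Set.ncard_le_ncard (graphThickening_mono h) (hfin n)
  obtain ⟨j, hj, hwin⟩ := exists_mul_increment_le hJ0 fun j => b (K + (K + 1) * j)
  simp only [mul_zero, add_zero] at hwin
  set a := K + (K + 1) * j with ha
  have ha' : K + (K + 1) * (j + 1) = a + K + 1 := by rw [ha]; ring
  rw [ha'] at hwin
  have haR : a + K + 1 ≤ K + (K + 1) * J := by
    rw [← ha']; gcongr; omega
  have hbd := ncard_vertexBoundary_graphThickening_le hY hball hA (a + K)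
  rw [← hb, ← hb] at hbd
  have hk' := (abs_le.mp (hk _ (hfin (a + K)))).1
  have hsplit := ncard_preimage_sdiff hfib (subset_graphThickening (Y := Y) (A := A) (a + K))
    (hfin (a + K))
  have hgain : b a - b K ≤ β * (f ⁻¹' (graphThickening Y A (a + K) \ A)).ncard := by
    have h1 := ncard_le_mul_ncard_preimage hβ hball hf hfib
      (P := graphThickening Y A a \ graphThickening Y A K)
      (Q := graphThickening Y A (a + K) \ A) ((hfin _).subset Set.sdiff_subset) (by
        rintro y ⟨hy, hyK⟩ z hz
        refine ⟨mem_graphThickening_add hY hy hz, fun hzA => hyK ⟨z, hzA, ?_⟩⟩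
        rwa [SimpleGraph.dist_comm])
    have h2 := Set.ncard_sdiff_add_ncard_of_subset
      (graphThickening_mono (Y := Y) (A := A) (show K ≤ a by omega)) (hfin a)
    rw [hb, hb, sub_le_iff_le_add]
    exact_mod_cast (by omega : _ ≤ _ + _)
  have m1 := hbmono a (a + K) (by omega)
  have m2 := hbmono (a + K) (a + K + 1) (by omega)
  have m3 := hbmono (a + K + 1) _ haR
  have m4 := hbmono K a (by omega)
  rw [← hb] at hk'
  have hr' : (1 : ℝ) ≤ r := by exact_mod_cast hr
  have hs' : (1 : ℝ) ≤ s := by exact_mod_cast hs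
  have hβ1 : (1 : ℝ) ≤ β := by exact_mod_cast hβ0
  have goal : (r * (f ⁻¹' A).ncard : ℝ) ≤ s * b (K + (K + 1) * J) := by
    generalize b (K + (K + 1) * J) = z at *
    generalize b (a + K + 1) = q at *
    generalize b (a + K) = p at *
    generalize b a = o at *
    generalize b K = l at *
    generalize ((f ⁻¹' A).ncard : ℝ) = u at *
    generalize ((f ⁻¹' (graphThickening Y A (a + K) \ A)).ncard : ℝ) = v at *
    -- After generalization, `v ≥ 0` is recovered from `hgain` and monotonicity.
    have hv : 0 ≤ v := by
      by_contra! h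
      nlinarith
    have e1 : r * u ≤ s * p + C * (q - p) - v := by
      have := mul_le_mul_of_nonneg_left hbd hC.le
      rw [hsplit] at hk'
      nlinarith
    have e2 : (C * β + 1) * (q - o) ≤ z - l :=
      (mul_le_mul_of_nonneg_right hJ (by linarith)).trans hwin
    -- In `e2`, split `z - l = (z - p) + (p - o) + (o - l)`. The `+ 1` in the choice of `J` pays for
    -- `p - o ≤ q - o`, and `hgain` bounds `o - l` by `β * v`.
    have e3 : β * (C * (q - p)) ≤ β * (s * (z - p)) + β * v := by
      have h1 : β * (C * (q - p)) ≤ β * (C * (q - o)) := by gcongr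
      have h2 : z - p ≤ β * (s * (z - p)) := by
        have : (1 : ℝ) ≤ β * s := one_le_mul_of_one_le_of_one_le hβ1 hs'
        nlinarith
      nlinarith
    have e4 : C * (q - p) ≤ s * (z - p) + v := by
      rw [← mul_add] at e3
      exact le_of_mul_le_mul_left e3 hβ'
    linarith
  rw [hb] at goal
  exact_mod_cast goal

/-- Hall's condition from range to domain. Here the estimate is applied to the inner neighborhood of
a slow window, and the boundary error is absorbed by the points gained inside it and by the fibers
over the annulus outside it. -/
theorem exists_mul_ncard_le_preimage (hY : Y.Connected)
    (hball : ∀ y n, {w | Y.dist y w ≤ n}.Finite)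
    (hβ : ∀ y, {w | Y.dist y w ≤ K}.ncard ≤ β) (hβ0 : 0 < β)
    (hf : ∀ y, ∃ x, Y.dist y (f x) ≤ K) (hfib : ∀ Q : Set W, Q.Finite → (f ⁻¹' Q).Finite)
    (hr : 1 ≤ r) (hs : 1 ≤ s) (hC : 0 < C)
    (hk : ∀ A : Set W, A.Finite →
      |(s * A.ncard : ℝ) - r * (f ⁻¹' A).ncard| ≤ C * (vertexBoundary Y A).ncard) :
    ∃ R : ℕ, ∀ A : Set W, A.Finite →
      s * A.ncard ≤ r * (f ⁻¹' graphThickening Y A R).ncard := by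
  obtain ⟨J, hJ⟩ := exists_nat_ge (C * β + 1)
  have hβ' : (0 : ℝ) < β := by exact_mod_cast hβ0
  have hJ0 : 0 < J := by
    have : (0 : ℝ) < J := lt_of_lt_of_le (by positivity) hJ
    exact_mod_cast this
  -- The final `+ K` leaves room for the `K`-balls around points of the last window.
  refine ⟨(K + 1) * J + K, fun A hA => ?_⟩
  have hfin := finite_graphThickening hball hA
  obtain ⟨b, hb⟩ : ∃ b : ℕ → ℝ, ∀ n, b n = ((graphThickening Y A n).ncard : ℝ) := ⟨_, fun _ => rfl⟩
  have hbmono : ∀ m n, m ≤ n → b m ≤ b n := fun m n h => by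
    rw [hb, hb]; exact_mod_cast Set.ncard_le_ncard (graphThickening_mono h) (hfin n)
  obtain ⟨j, hj, hwin⟩ := exists_mul_increment_le hJ0 fun j => b ((K + 1) * j)
  simp only [mul_zero] at hwin
  set a := (K + 1) * j with ha
  have ha' : (K + 1) * (j + 1) = a + K + 1 := by rw [ha]; ring
  rw [ha'] at hwin
  have haR : a + K + 1 ≤ (K + 1) * J := by
    rw [← ha']; gcongr; omega
  have hbd := ncard_vertexBoundary_graphThickening_le hY hball hA a
  rw [← hb, ← hb] at hbd
  have hk' := (abs_le.mp (hk _ (hfin a))).2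
  have hsplit := ncard_preimage_sdiff hfib (graphThickening_mono (Y := Y) (A := A)
    (show a ≤ (K + 1) * J + K by omega)) (hfin ((K + 1) * J + K))
  have hgain : b ((K + 1) * J) - b (a + K) ≤ β * (f ⁻¹' (graphThickening Y A ((K + 1) * J + K) \
      graphThickening Y A a)).ncard := by
    have h1 := ncard_le_mul_ncard_preimage hβ hball hf hfib
      (P := graphThickening Y A ((K + 1) * J) \ graphThickening Y A (a + K))
      (Q := graphThickening Y A ((K + 1) * J + K) \ graphThickening Y A a)
      ((hfin _).subset Set.sdiff_subset) (by
        rintro y ⟨hy, hyK⟩ z hz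
        refine ⟨mem_graphThickening_add hY hy hz,
          fun hzA => hyK (mem_graphThickening_add hY hzA ?_)⟩
        rwa [SimpleGraph.dist_comm])
    have h2 := Set.ncard_sdiff_add_ncard_of_subset
      (graphThickening_mono (Y := Y) (A := A) (show a + K ≤ (K + 1) * J by omega)) (hfin _)
    rw [hb, hb, sub_le_iff_le_add]
    exact_mod_cast (by omega : _ ≤ _ + _)
  have m0 : (A.ncard : ℝ) ≤ b 0 := by
    rw [hb]; exact_mod_cast Set.ncard_le_ncard (subset_graphThickening 0) (hfin 0)
  have m1 := hbmono 0 a (by omega)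
  have m2 := hbmono a (a + 1) (by omega)
  have m3 := hbmono (a + 1) (a + K + 1) (by omega)
  have m4 := hbmono (a + K) (a + K + 1) (by omega)
  have m5 := hbmono (a + K + 1) _ haR
  have m6 := hbmono a (a + K) (by omega)
  rw [← hb] at hk'
  have hr' : (1 : ℝ) ≤ r := by exact_mod_cast hr
  have hs' : (1 : ℝ) ≤ s := by exact_mod_cast hs
  have hβ1 : (1 : ℝ) ≤ β := by exact_mod_cast hβ0
  have goal : (s * A.ncard : ℝ) ≤
      r * (f ⁻¹' graphThickening Y A ((K + 1) * J + K)).ncard := by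
    rw [hsplit]
    generalize b ((K + 1) * J) = z at *
    generalize b (a + K + 1) = q at *
    generalize b (a + K) = p at *
    generalize b (a + 1) = o at *
    generalize b a = m at *
    generalize b 0 = l at *
    generalize (A.ncard : ℝ) = c at *
    generalize ((f ⁻¹' graphThickening Y A a).ncard : ℝ) = u at *
    generalize ((f ⁻¹' (graphThickening Y A ((K + 1) * J + K) \
      graphThickening Y A a)).ncard : ℝ) = v at *
    have hv : 0 ≤ v := by
      by_contra! h
      nlinarith
    have e1 : s * m - C * (o - m) ≤ r * u := by
      have := mul_le_mul_of_nonneg_left hbd hC.le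
      linarith
    have e2 : (C * β + 1) * (q - m) ≤ z - l :=
      (mul_le_mul_of_nonneg_right hJ (by linarith)).trans hwin
    have e3 : β * (C * (o - m)) ≤ β * (s * (m - l)) + β * v := by
      have h1 : β * (C * (o - m)) ≤ β * (C * (q - m)) := by gcongr
      have h2 : m - l ≤ β * (s * (m - l)) := by
        have : (1 : ℝ) ≤ β * s := one_le_mul_of_one_le_of_one_le hβ1 hs'
        nlinarith
      nlinarith
    have e4 : C * (o - m) ≤ s * (m - l) + v := by
      rw [← mul_add] at e3
      exact le_of_mul_le_mul_left e3 hβ'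
    have e5 : (s : ℝ) * c ≤ s * l := by gcongr
    have e6 : v ≤ r * v := by nlinarith
    linarith
  exact_mod_cast goal

/-- A coarsely onto map `f` with `|s |A| - r |f⁻¹(A)|| ≤ C |∂A|` for all finite `A` is at bounded
distance from a bijection between `r` copies of the domain and `s` copies of the range. -/
theorem exists_equiv_prod_fin_dist_le (hY : Y.Connected)
    (hball : ∀ y n, {w | Y.dist y w ≤ n}.Finite)
    (hβ : ∀ y, {w | Y.dist y w ≤ K}.ncard ≤ β) (hβ0 : 0 < β)
    (hf : ∀ y, ∃ x, Y.dist y (f x) ≤ K) (hfib : ∀ Q : Set W, Q.Finite → (f ⁻¹' Q).Finite)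
    (hr : 1 ≤ r) (hs : 1 ≤ s) (hC : 0 < C)
    (hk : ∀ A : Set W, A.Finite →
      |(s * A.ncard : ℝ) - r * (f ⁻¹' A).ncard| ≤ C * (vertexBoundary Y A).ncard) :
    ∃ (R : ℕ) (φ : V × Fin r ≃ W × Fin s), ∀ p, Y.dist (f p.1) (φ p).1 ≤ R := by
  classical
  obtain ⟨R₁, h₁⟩ := exists_mul_ncard_preimage_le hY hball hβ hβ0 hf hfib hr hs hC hk
  obtain ⟨R₂, h₂⟩ := exists_mul_ncard_le_preimage hY hball hβ hβ0 hf hfib hr hs hC hk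
  have inj₁ : ∃ g : V × Fin r → W × Fin s, Function.Injective g ∧
      ∀ p, g p ∈ (hball (f p.1) R₁).toFinset ×ˢ (Finset.univ : Finset (Fin s)) := by
    rw [← Finset.all_card_le_biUnion_card_iff_exists_injective]
    intro B
    -- The targets allowed to `(x, i)` do not depend on `i`, so Hall's condition may be checked on
    -- all `r` copies of the projection of `B`.
    set A : Finset V := B.image Prod.fst with hA
    have hsub : (hfib _ (A.image f).finite_toSet |>.toFinset) ⊇ A := by
      intro x hx
      simp only [Set.Finite.mem_toFinset, Set.mem_preimage, Finset.coe_image]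
      exact Set.mem_image_of_mem f hx
    have hT := finite_graphThickening hball (A.image f).finite_toSet R₁
    have hU : hT.toFinset ×ˢ (Finset.univ : Finset (Fin s)) ⊆
        B.biUnion fun p => (hball (f p.1) R₁).toFinset ×ˢ (Finset.univ : Finset (Fin s)) := by
      rintro ⟨y, i⟩ hy
      simp only [Finset.mem_product, Set.Finite.mem_toFinset, Finset.mem_univ, and_true] at hy
      obtain ⟨a, ha, hay⟩ := hy
      rw [Finset.mem_coe, Finset.mem_image] at ha
      obtain ⟨x, hx, rfl⟩ := ha
      rw [hA, Finset.mem_image] at hx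
      obtain ⟨p, hp, rfl⟩ := hx
      rw [Finset.mem_biUnion]
      exact ⟨p, hp, by simpa using hay⟩
    calc B.card ≤ r * A.card := card_le_mul_card_image_fst B
      _ ≤ r * (f ⁻¹' ((A.image f : Finset W) : Set W)).ncard := by
        rw [Set.ncard_eq_toFinset_card _ (hfib _ (A.image f).finite_toSet)]
        exact Nat.mul_le_mul_left _ (Finset.card_le_card hsub)
      _ ≤ s * (graphThickening Y ((A.image f : Finset W) : Set W) R₁).ncard :=
        h₁ _ (A.image f).finite_toSet
      _ = (hT.toFinset ×ˢ (Finset.univ : Finset (Fin s))).card := by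
        rw [Set.ncard_eq_toFinset_card _ hT, Finset.card_product, Finset.card_fin, mul_comm]
      _ ≤ _ := Finset.card_le_card hU
  have inj₂ : ∃ g : W × Fin s → V × Fin r, Function.Injective g ∧
      ∀ p, g p ∈ (hfib _ (hball p.1 R₂)).toFinset ×ˢ (Finset.univ : Finset (Fin r)) := by
    rw [← Finset.all_card_le_biUnion_card_iff_exists_injective]
    intro B
    set A : Finset W := B.image Prod.fst with hA
    have hT := hfib _ (finite_graphThickening hball A.finite_toSet R₂)
    have hU : hT.toFinset ×ˢ (Finset.univ : Finset (Fin r)) ⊆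
        B.biUnion fun p => (hfib _ (hball p.1 R₂)).toFinset ×ˢ (Finset.univ : Finset (Fin r)) := by
      rintro ⟨x, i⟩ hx
      simp only [Finset.mem_product, Set.Finite.mem_toFinset, Finset.mem_univ, and_true] at hx
      obtain ⟨a, ha, hax⟩ := hx
      rw [Finset.mem_coe, hA, Finset.mem_image] at ha
      obtain ⟨p, hp, rfl⟩ := ha
      rw [Finset.mem_biUnion]
      exact ⟨p, hp, by simpa using hax⟩
    calc B.card ≤ s * A.card := card_le_mul_card_image_fst B
      _ = s * (A : Set W).ncard := by rw [Set.ncard_coe_finset]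
      _ ≤ r * (f ⁻¹' graphThickening Y (A : Set W) R₂).ncard := h₂ _ A.finite_toSet
      _ = (hT.toFinset ×ˢ (Finset.univ : Finset (Fin r))).card := by
        rw [Set.ncard_eq_toFinset_card _ hT, Finset.card_product, Finset.card_fin, mul_comm]
      _ ≤ _ := Finset.card_le_card hU
  obtain ⟨g₁, hg₁, hR₁⟩ := inj₁
  obtain ⟨g₂, hg₂, hR₂⟩ := inj₂
  have hp₁ : ∀ p, Y.dist (f p.1) (g₁ p).1 ≤ max R₁ R₂ := fun p => by
    have := hR₁ p
    simp only [Finset.mem_product, Set.Finite.mem_toFinset, Finset.mem_univ, and_true] at this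
    exact le_max_of_le_left this
  have hp₂ : ∀ q, Y.dist (f (g₂ q).1) q.1 ≤ max R₁ R₂ := fun q => by
    have := hR₂ q
    simp only [Finset.mem_product, Set.Finite.mem_toFinset, Finset.mem_univ, and_true] at this
    rw [SimpleGraph.dist_comm]
    exact le_max_of_le_right this
  -- Every pair matched by the bijection comes from `g₁` or from `g₂`, so the displacement bound
  -- survives.
  obtain ⟨h, hh, hR⟩ := Function.Embedding.schroeder_bernstein_of_rel hg₁ hg₂
    (fun p q => Y.dist (f p.1) q.1 ≤ max R₁ R₂) hp₁ hp₂
  exact ⟨max R₁ R₂, Equiv.ofBijective h hh, hR⟩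

end Matching

/-! ## Lamp configurations -/

/-- The lamp at `y` of the new configuration consists of the digits which `φ` brings to `y`, where
`eE` and `eF` write the elements of `E` and `F` with `r` and `s` digits in `A`. -/
def recode {X Y E F A : Type*} {r s : ℕ} (φ : X × Fin r ≃ Y × Fin s) (eE : E ≃ (Fin r → A))
    (eF : F ≃ (Fin s → A)) (c : X → E) : Y → F :=
  fun y => eF.symm fun j => eE (c (φ.symm (y, j)).1) (φ.symm (y, j)).2

section Recode

variable {X Y E F A : Type*} {r s : ℕ} (φ : X × Fin r ≃ Y × Fin s) (eE : E ≃ (Fin r → A))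
  (eF : F ≃ (Fin s → A))

theorem recode_symm_recode (c : X → E) : recode φ.symm eF eE (recode φ eE eF c) = c := by
  funext x
  rw [recode, Equiv.symm_apply_eq]
  funext i
  simp [recode]

variable {φ eE eF}

theorem recode_congr {c c' : X → E} {y : Y}
    (h : ∀ j, c (φ.symm (y, j)).1 = c' (φ.symm (y, j)).1) :
    recode φ eE eF c y = recode φ eE eF c' y := by
  simp only [recode, h]

theorem recode_mem_groupDirectSum [Group E] [Group F] {a : A} (hE : eE 1 = fun _ => a)
    (hF : eF 1 = fun _ => a) {c : X → E} (hc : c ∈ groupDirectSum X E) :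
    recode φ eE eF c ∈ groupDirectSum Y F := by
  rw [mem_groupDirectSum] at hc ⊢
  have hfin : (⋃ x ∈ Function.mulSupport c, Set.range fun i => (φ (x, i)).1).Finite :=
    hc.biUnion fun x _ => Set.finite_range _
  refine hfin.subset fun y hy => ?_
  by_contra hy'
  refine hy ?_
  -- Off the finite set, every letter sent to `y` comes from a trivial lamp, so `c` may be replaced
  -- by the trivial configuration.
  have h1 : recode φ eE eF c y = recode φ eE eF 1 y := by
    refine recode_congr fun j => ?_
    by_contra hne
    exact hy' (Set.mem_biUnion (x := (φ.symm (y, j)).1) hne ⟨(φ.symm (y, j)).2, by simp⟩)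
  rw [h1, recode, Equiv.symm_apply_eq, hF]
  funext j
  simp [hE]

end Recode

/-! ## Permutational wreath products -/

section Wreath

variable {E F G H X Y A : Type*} [Group E] [Group F] [Group G] [Group H] [MulAction G X]
  [MulAction H Y] {r s : ℕ}

/-- The bijection between permutational wreath products which recodes the lamps by `φ` and
moves the cursor by `ψ`. -/
def wreathEquiv (φ : X × Fin r ≃ Y × Fin s) {eE : E ≃ (Fin r → A)} {eF : F ≃ (Fin s → A)} {a : A}
    (hE : eE 1 = fun _ => a) (hF : eF 1 = fun _ => a) (ψ : G ≃ H) :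
    PermWreath E X G ≃ PermWreath F Y H where
  toFun w := ⟨⟨recode φ eE eF w.left.1, recode_mem_groupDirectSum hE hF w.left.2⟩, ψ w.right⟩
  invFun w :=
    ⟨⟨recode φ.symm eF eE w.left.1, recode_mem_groupDirectSum hF hE w.left.2⟩, ψ.symm w.right⟩
  left_inv w := by
    ext1
    · exact Subtype.ext (recode_symm_recode φ eE eF w.left.1)
    · exact ψ.symm_apply_apply _
  right_inv w := by
    ext1
    · exact Subtype.ext (recode_symm_recode φ.symm eF eE w.left.1)
    · exact ψ.apply_symm_apply _

open Classical in
/-- The configuration whose only lamp with a nontrivial value is at `o`, with value `e`. -/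
noncomputable def singleLamp (o : X) (e : E) : groupDirectSum X E :=
  ⟨Pi.mulSingle o e, (Set.finite_singleton o).subset Pi.mulSupport_mulSingle_subset⟩

theorem singleLamp_apply_of_ne {o x : X} (h : x ≠ o) (e : E) : (singleLamp o e).1 x = 1 := by
  simp [singleLamp, h]

theorem permAction_singleLamp (g : G) (o : X) (e : E) :
    permAction E X G g (singleLamp o e) = singleLamp (g • o) e := by
  ext x
  change (singleLamp o e).1 (g⁻¹ • x) = _
  by_cases h : x = g • o
  · subst h
    simp [singleLamp]
  · rw [singleLamp_apply_of_ne h, singleLamp_apply_of_ne]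
    rwa [ne_eq, inv_smul_eq_iff]

/-- Conjugating by the cursor moves a lamp from `o` to any point of its orbit, here all of `X`; a
finitely supported configuration is then peeled off one lamp at a time. -/
theorem closure_lampGenerators {S : Set G} (hS : Subgroup.closure S = ⊤) {o : X}
    (ho : ∀ x : X, ∃ g : G, g • o = x) :
    Subgroup.closure (SemidirectProduct.inr '' S ∪
      Set.range fun e : E => SemidirectProduct.inl (singleLamp o e) : Set (PermWreath E X G)) =
      ⊤ := by
  set P : Subgroup (PermWreath E X G) := Subgroup.closure (SemidirectProduct.inr '' S ∪
      Set.range fun e : E => SemidirectProduct.inl (singleLamp o e)) with hP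
  have hinr : ∀ g : G, (SemidirectProduct.inr g : PermWreath E X G) ∈ P := by
    have : Subgroup.map SemidirectProduct.inr (Subgroup.closure S) ≤ P := by
      rw [MonoidHom.map_closure]
      exact Subgroup.closure_mono Set.subset_union_left
    intro g
    exact this ⟨g, hS ▸ Subgroup.mem_top g, rfl⟩
  have hsingle : ∀ (x : X) (e : E),
      (SemidirectProduct.inl (singleLamp x e) : PermWreath E X G) ∈ P := by
    intro x e
    obtain ⟨g, rfl⟩ := ho x
    rw [← permAction_singleLamp, SemidirectProduct.inl_aut]
    exact mul_mem (mul_mem (hinr g) (Subgroup.subset_closure (Or.inr ⟨e, rfl⟩))) (hinr g⁻¹)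
  have hinl : ∀ (B : Finset X) (c : groupDirectSum X E), Function.mulSupport c.1 ⊆ B →
      (SemidirectProduct.inl c : PermWreath E X G) ∈ P := by
    classical
    intro B
    induction B using Finset.induction_on with
    | empty =>
      intro c hc
      have : c = 1 := Subtype.ext (Function.mulSupport_eq_empty_iff.mp
        (Set.subset_empty_iff.mp (by simpa using hc)))
      rw [this, map_one]
      exact one_mem P
    | insert x B _ ih =>
      intro c hc
      have hmul : c = singleLamp x (c.1 x) * ((singleLamp x (c.1 x))⁻¹ * c) := by group
      rw [hmul, map_mul]
      refine mul_mem (hsingle _ _) (ih _ fun y hy => ?_)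
      by_cases hyx : y = x
      · subst hyx
        exact absurd (by simp [singleLamp]) hy
      · have hyc : y ∈ Function.mulSupport c.1 := by
          intro h
          refine hy ?_
          change ((singleLamp x (c.1 x)).1 y)⁻¹ * c.1 y = 1
          rw [singleLamp_apply_of_ne hyx, h, inv_one, one_mul]
        simpa [hyx] using hc hyc
  rw [eq_top_iff]
  intro w _
  rw [← SemidirectProduct.inl_left_mul_inr_right w]
  exact mul_mem (hinl (Set.Finite.toFinset w.left.2) _ (Set.Finite.coe_toFinset _).ge) (hinr _)

theorem permWreath_fg [Finite E] {S : Set G} (hS : IsFiniteGeneratingSet S) {o : X}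
    (ho : ∀ x : X, ∃ g : G, g • o = x) : Group.FG (PermWreath E X G) :=
  Group.fg_iff.mpr ⟨_, closure_lampGenerators hS.2 ho,
    (hS.1.image _).union (Set.finite_range _)⟩

theorem finite_configurations [Finite F] {Z : Set Y} (hZ : Z.Finite) :
    {d : groupDirectSum Y F | Function.mulSupport d.1 ⊆ Z}.Finite := by
  have := hZ.to_subtype
  refine Set.Finite.of_injOn (f := fun d (z : Z) => d.1 z.1) (t := Set.univ)
    (fun _ _ => Set.mem_univ _) ?_ Set.finite_univ
  intro d hd d' hd' h
  ext y
  by_cases hy : y ∈ Z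
  · exact congrFun h ⟨y, hy⟩
  · rw [Function.notMem_mulSupport.mp fun h => hy (hd h),
      Function.notMem_mulSupport.mp fun h => hy (hd' h)]

/-- `Z` contains, in the frame of the new cursor, every site receiving a letter of the lamp under
the old cursor. -/
theorem hasFiniteIncrements_wreathEquiv [Finite F] (φ : X × Fin r ≃ Y × Fin s)
    {eE : E ≃ (Fin r → A)} {eF : F ≃ (Fin s → A)} {a : A} (hE : eE 1 = fun _ => a)
    (hF : eF 1 = fun _ => a) {ψ : G ≃ H} (hψ : HasFiniteIncrements ψ) {o : X}
    (ho : ∀ x : X, ∃ g : G, g • o = x) {Z : Set Y} (hZ : Z.Finite)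
    (hφ : ∀ g i, (ψ g)⁻¹ • (φ (g • o, i)).1 ∈ Z) :
    HasFiniteIncrements (wreathEquiv φ hE hF ψ) := by
  refine HasFiniteIncrements.of_closure
    (closure_lampGenerators (S := Set.univ) (Subgroup.closure_univ) ho) ?_
  rintro _ (⟨g₀, -, rfl⟩ | ⟨e, rfl⟩)
  · refine ((hψ g₀).image SemidirectProduct.inr).subset ?_
    rintro _ ⟨w, rfl⟩
    refine ⟨_, ⟨w.right, rfl⟩, ?_⟩
    have hw : (wreathEquiv φ hE hF ψ (w * SemidirectProduct.inr g₀)) =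
        wreathEquiv φ hE hF ψ w * SemidirectProduct.inr ((ψ w.right)⁻¹ * ψ (w.right * g₀)) := by
      ext1
      · simp [wreathEquiv]
      · simp [wreathEquiv]
    simp only [hw, inv_mul_cancel_left]
  · refine ((finite_configurations hZ).image SemidirectProduct.inl).subset ?_
    rintro _ ⟨w, rfl⟩
    refine ⟨((wreathEquiv φ hE hF ψ w)⁻¹ *
      wreathEquiv φ hE hF ψ (w * SemidirectProduct.inl (singleLamp o e))).left, ?_, ?_⟩
    · intro y hy
      by_contra hyZ
      refine hy ?_
      -- Unfolding the increment's lamp at `y`: the inverse of the cursor translates `y` back to the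
      -- site `ψ w.right • y`.
      change (recode φ eE eF w.left.1 ((ψ w.right)⁻¹⁻¹ • y))⁻¹ *
        recode φ eE eF (w.left.1 * fun x => (singleLamp o e).1 (w.right⁻¹ • x))
          ((ψ w.right)⁻¹⁻¹ • y) = 1
      rw [inv_mul_eq_one]
      refine recode_congr fun j => ?_
      rw [Pi.mul_apply, singleLamp_apply_of_ne, mul_one]
      intro hx
      rw [inv_smul_eq_iff] at hx
      refine hyZ ?_
      have := hφ w.right (φ.symm ((ψ w.right)⁻¹⁻¹ • y, j)).2
      rw [← hx] at this
      simpa using this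
    · ext1
      · simp
      · simp [wreathEquiv]

end Wreath

/-! ## Quasi-isometries between Cayley graphs -/

theorem IsQuasiIsometry.exists_nat_bounds {V W : Type*} {X : SimpleGraph V} {Y : SimpleGraph W}
    {f : V → W} (h : IsQuasiIsometry X Y f) :
    ∃ C K : ℕ, (∀ x y, Y.dist (f x) (f y) ≤ C * X.dist x y + K) ∧
      (∀ x y, X.dist x y ≤ C * Y.dist (f x) (f y) + K) ∧ ∀ y, ∃ x, Y.dist y (f x) ≤ K := by
  obtain ⟨c, k, hc, hk, hu, hl, hd⟩ := h
  obtain ⟨C, hC⟩ := exists_nat_ge c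
  -- Clearing `1 / c` in the lower bound turns the additive constant into `c * k`, which dominates
  -- `k` because `1 ≤ c`.
  obtain ⟨K, hK⟩ := exists_nat_ge (c * k)
  have hkK : k ≤ K := le_trans (by nlinarith) hK
  refine ⟨C, K, fun x y => ?_, fun x y => ?_, fun y => ?_⟩
  · have h1 : c * X.dist x y ≤ C * X.dist x y := by gcongr
    exact_mod_cast (show (Y.dist (f x) (f y) : ℝ) ≤ C * X.dist x y + K by linarith [hu x y])
  · have h1 : c * Y.dist (f x) (f y) ≤ C * Y.dist (f x) (f y) := by gcongr
    have h2 := hl x y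
    rw [sub_le_iff_le_add, one_div, inv_mul_le_iff₀ (by linarith)] at h2
    exact_mod_cast (show (X.dist x y : ℝ) ≤ C * Y.dist (f x) (f y) + K by linarith)
  · obtain ⟨x, hx⟩ := hd y
    exact ⟨x, by exact_mod_cast hx.trans hkK⟩

theorem IsQuasiToOne.exists_equiv_prod_fin {G H : Type*} [Group G] [Group H] {S : Set G}
    {T : Set H} (hS : IsFiniteGeneratingSet S) (hT : IsFiniteGeneratingSet T) {r s : ℕ}
    (hr : 1 ≤ r) (hs : 1 ≤ s) {f : G → H}
    (h : IsQuasiToOne (SimpleGraph.mulCayley S) (SimpleGraph.mulCayley T) ((s : ℝ) / r) f) :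
    ∃ (R : ℕ) (φ : G × Fin r ≃ H × Fin s),
      ∀ p, (SimpleGraph.mulCayley T).dist (f p.1) (φ p).1 ≤ R := by
  obtain ⟨hqi, C, hC, hk⟩ := h
  obtain ⟨D, K, -, hl, hd⟩ := hqi.exists_nat_bounds
  have hr0 : (0 : ℝ) < r := by exact_mod_cast hr
  -- Each nonempty fiber lies in a `K`-ball by the lower quasi-isometry bound.
  have hfib : ∀ Q : Set H, Q.Finite → (f ⁻¹' Q).Finite := by
    intro Q hQ
    refine hQ.preimage' fun b _ => ?_
    by_cases hb : ∃ x, f x = b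
    · obtain ⟨x, rfl⟩ := hb
      refine (mulCayley_ball_finite' hS x K).subset fun z hz => ?_
      have := hl x z
      rwa [show f z = f x from hz, SimpleGraph.dist_self, mul_zero, zero_add] at this
    · exact Set.finite_empty.subset fun z hz => hb ⟨z, hz⟩
  refine exists_equiv_prod_fin_dist_le (mulCayley_connected hT.2) (mulCayley_ball_finite' hT)
    (fun y => (mulCayley_ball_ncard hT.2 y K).le)
    ((Set.ncard_pos (mulCayley_ball_finite hT K)).mpr ⟨1, by simp⟩) hd hfib hr hs
    (mul_pos hr0 hC) fun A hA => ?_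
  -- Multiplying by `r` clears the denominator of `s / r`; the boundary constant becomes `r * C`.
  have h1 := mul_le_mul_of_nonneg_left (hk hA.toFinset) hr0.le
  rw [← abs_of_pos hr0, ← abs_mul, abs_of_pos hr0, ← Set.ncard_eq_toFinset_card A hA,
    Set.Finite.coe_toFinset, mul_sub, ← mul_assoc, mul_div_cancel₀ _ hr0.ne', ← mul_assoc] at h1
  exact h1

/-! ## Quotients by normal subgroups -/

section Quotient

variable {G : Type*} [Group G] (M : Subgroup G) [M.Normal] {S : Set G}

theorem IsFiniteGeneratingSet.quotientSet (hS : IsFiniteGeneratingSet S) :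
    IsFiniteGeneratingSet (quotientSet M S) := by
  refine ⟨hS.1.image _, ?_⟩
  have := MonoidHom.map_closure (QuotientGroup.mk' M) S
  rw [hS.2, ← MonoidHom.range_eq_map, QuotientGroup.range_mk'] at this
  exact this.symm

theorem quotient_dist_le (hS : IsFiniteGeneratingSet S) (x y : G) :
    (SimpleGraph.mulCayley (quotientSet M S)).dist (x : G ⧸ M) (y : G ⧸ M) ≤
      (SimpleGraph.mulCayley S).dist x y := by
  have hc := mulCayley_connected (hS.quotientSet M).2
  refine ((mulCayley_connected hS.2).dist_map_le hc (φ := fun g : G => (g : G ⧸ M)) (D := 1)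
    ?_ x y).trans (one_mul _).le
  intro a b hab
  by_cases h : (a : G ⧸ M) = b
  · simp [h]
  · refine (SimpleGraph.dist_eq_one_iff_adj.mpr ?_).le
    rw [SimpleGraph.mulCayley_adj] at hab ⊢
    exact ⟨h, hab.2.imp (fun h => ⟨_, h, rfl⟩) (fun h => ⟨_, h, rfl⟩)⟩

theorem quotient_dist_one_inv_smul (hS : IsFiniteGeneratingSet S) (g : G) (x : G ⧸ M) :
    (SimpleGraph.mulCayley (quotientSet M S)).dist 1 (g⁻¹ • x) =
      (SimpleGraph.mulCayley (quotientSet M S)).dist (g : G ⧸ M) x := by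
  obtain ⟨z, rfl⟩ := QuotientGroup.mk_surjective x
  exact mulCayley_dist_one (hS.quotientSet M).2 (g : G ⧸ M) (z : G ⧸ M)

end Quotient

theorem IsInducedMap.exists_dist_le {G H : Type*} [Group G] [Group H] {M : Subgroup G} {N : Subgroup H} [N.Normal]
    {T : Set H} (hT : IsFiniteGeneratingSet T) {f : G → H} {fbar : G ⧸ M → H ⧸ N}
    (h : IsInducedMap M N (SimpleGraph.mulCayley T) f fbar) :
    ∃ Q : ℕ, ∀ g : G,
      (SimpleGraph.mulCayley (quotientSet N T)).dist (f g : H ⧸ N) (fbar (g : G ⧸ M)) ≤ Q := by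
  obtain ⟨q, hq⟩ := h
  obtain ⟨Q, hQ⟩ := exists_nat_ge q
  refine ⟨Q, fun g => ?_⟩
  obtain ⟨b, hb, hgb⟩ := (hq (g : G ⧸ M)).1 (f g) ⟨g, rfl, rfl⟩
  rw [← show (b : H ⧸ N) = fbar (g : G ⧸ M) from hb]
  exact (quotient_dist_le N hT _ _).trans (by exact_mod_cast hgb.trans hQ)

/-- The elements of a set of cardinality `n ^ r` are the words of length `r` in `n` letters. -/
theorem exists_equiv_digits {E : Type*} [Group E] [Finite E] {n r : ℕ} (hE : Nat.card E = n ^ r)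
    (a : Fin n) : ∃ e : E ≃ (Fin r → Fin n), e 1 = fun _ => a := by
  classical
  obtain ⟨e⟩ : Nonempty (E ≃ (Fin r → Fin n)) := Finite.card_eq.mp (by simp [hE])
  -- The swap normalizes the word of the identity.
  exact ⟨e.trans (Equiv.swap (e 1) fun _ => a), by simp⟩

theorem proposition6p1
    {E : Type*} {F : Type*} {G : Type*} {H : Type*}
    [Group E] [Finite E] [Nontrivial E] [Group F] [Finite F] [Nontrivial F]
    [Group G] [Group H]
    (S : Set G) (hS : IsFiniteGeneratingSet S) (T : Set H) (hT : IsFiniteGeneratingSet T)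
    (M : Subgroup G) [M.Normal] (N : Subgroup H) [N.Normal]
    (hM : IsCoAmenable M)
    (n r s : ℕ) (hn : 1 ≤ n) (hr : 1 ≤ r) (hs : 1 ≤ s)
    (hE : Nat.card E = n ^ r) (hF : Nat.card F = n ^ s)
    (f : G → H)
    (hf : IsQuasiIsometryOfPairs (SimpleGraph.mulCayley S) (leftCosets M)
      (SimpleGraph.mulCayley T) (leftCosets N) f)
    (hf_one : IsQuasiToOne (SimpleGraph.mulCayley S) (SimpleGraph.mulCayley T) 1 f)
    (fbar : G ⧸ M → H ⧸ N)
    (hfbar : IsInducedMap M N (SimpleGraph.mulCayley T) f fbar)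
    (hfbar_k : IsQuasiToOne (SimpleGraph.mulCayley (quotientSet M S))
      (SimpleGraph.mulCayley (quotientSet N T)) ((s : ℝ) / (r : ℝ)) fbar) :
    BiLipschitzEquivalentGroups (PermWreath E (G ⧸ M) G) (PermWreath F (H ⧸ N) H) := by
  have hSM := hS.quotientSet M
  have hTN := hT.quotientSet N
  have hcT := mulCayley_connected hT.2
  have hcTN := mulCayley_connected hTN.2
  obtain ⟨eE, heE⟩ := exists_equiv_digits hE ⟨0, hn⟩
  obtain ⟨eF, heF⟩ := exists_equiv_digits hF ⟨0, hn⟩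
  obtain ⟨C, K, hup, hlow, -⟩ := hf.1.exists_nat_bounds
  obtain ⟨C', K', -, hlow', -⟩ := hfbar_k.1.exists_nat_bounds
  obtain ⟨R, φ, hφ⟩ := hfbar_k.exists_equiv_prod_fin hSM hTN hr hs
  obtain ⟨Q, hQ⟩ := hfbar.exists_dist_le hT
  obtain ⟨R₁, ψ, hψ⟩ : ∃ (R₁ : ℕ) (ψ : G ≃ H),
      ∀ g, (SimpleGraph.mulCayley T).dist (f g) (ψ g) ≤ R₁ := by
    obtain ⟨R₁, ψ, hψ⟩ := IsQuasiToOne.exists_equiv_prod_fin (r := 1) (s := 1) hS hT le_rfl le_rfl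
      (by simpa using hf_one)
    exact ⟨R₁, ((Equiv.prodUnique G (Fin 1)).symm.trans ψ).trans (Equiv.prodUnique H (Fin 1)),
      fun g => hψ (g, 0)⟩
  have hψinc : HasFiniteIncrements ψ := by
    refine hasFiniteIncrements_of_dist_le hT hS.2 (fun m => R₁ + (C * m + K) + R₁) fun x y => ?_
    refine (hcT.dist_triangle (v := f y)).trans (add_le_add ?_ (hψ y))
    refine (hcT.dist_triangle (v := f x)).trans (add_le_add ?_ (hup x y))
    rw [SimpleGraph.dist_comm]
    exact hψ x
  have hψinc' : HasFiniteIncrements ψ.symm := by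
    refine hasFiniteIncrements_of_dist_le hS hT.2 (fun m => C * (R₁ + m + R₁) + K) fun x y => ?_
    refine (hlow _ _).trans ?_
    gcongr
    have hx := hψ (ψ.symm x)
    have hy := hψ (ψ.symm y)
    rw [ψ.apply_symm_apply] at hx hy
    rw [SimpleGraph.dist_comm] at hy
    exact (hcT.dist_triangle (v := y)).trans
      (add_le_add ((hcT.dist_triangle (v := x)).trans (add_le_add hx le_rfl)) hy)
  have hcursor : ∀ g : G, (SimpleGraph.mulCayley (quotientSet N T)).dist (ψ g : H ⧸ N)
      (fbar (g : G ⧸ M)) ≤ R₁ + Q := by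
    intro g
    refine (hcTN.dist_triangle (v := (f g : H ⧸ N))).trans (add_le_add ?_ (hQ g))
    rw [SimpleGraph.dist_comm]
    exact (quotient_dist_le N hT _ _).trans (hψ g)
  have htrans : ∀ x : G ⧸ M, ∃ g : G, g • (1 : G ⧸ M) = x := MulAction.exists_smul_eq G 1
  have htrans' : ∀ y : H ⧸ N, ∃ h : H, h • (1 : H ⧸ N) = y := MulAction.exists_smul_eq H 1
  have hsmul : ∀ g : G, g • (1 : G ⧸ M) = (g : G ⧸ M) := fun g => congrArg _ (mul_one g)
  have hsmul' : ∀ h : H, h • (1 : H ⧸ N) = (h : H ⧸ N) := fun h => congrArg _ (mul_one h)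
  refine BiLipschitzEquivalentGroups.of_hasFiniteIncrements (permWreath_fg hS htrans)
    (permWreath_fg hT htrans') (wreathEquiv φ heE heF ψ) ?_ ?_
  · refine hasFiniteIncrements_wreathEquiv φ heE heF hψinc htrans
      (mulCayley_ball_finite hTN (R₁ + Q + R)) fun g i => ?_
    rw [hsmul, Set.mem_ofPred_eq, quotient_dist_one_inv_smul N hT]
    exact (hcTN.dist_triangle (v := fbar (g : G ⧸ M))).trans
      (add_le_add (hcursor g) (hφ ((g : G ⧸ M), i)))
  -- For the inverse, closeness is proved in `H ⧸ N` after applying `fbar`, then pulled back by its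
  -- lower bound.
  · refine hasFiniteIncrements_wreathEquiv φ.symm heF heE hψinc' htrans'
      (mulCayley_ball_finite hSM (C' * (R₁ + Q + R) + K')) fun h j => ?_
    rw [hsmul', Set.mem_ofPred_eq, quotient_dist_one_inv_smul M hS]
    refine (hlow' _ _).trans ?_
    gcongr
    have h1 := hcursor (ψ.symm h)
    have h2 := hφ (φ.symm ((h : H ⧸ N), j))
    rw [ψ.apply_symm_apply, SimpleGraph.dist_comm] at h1
    rw [φ.apply_symm_apply, SimpleGraph.dist_comm] at h2
    exact (hcTN.dist_triangle (v := (h : H ⧸ N))).trans (add_le_add h1 h2)
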